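/- **Setting.** Let $n,m,u\ge 0$ be integers, let parties $P_0,\dots,P_{n-1}$ hold private integers $x_0,\dots,x_{n-1}\in\{1,\dots,2^m-1\}$, and let $T=\mathrm{lcm}(x_0,\dots,x_{n-1})$. There are $u$-qubit registers $h,t$ and an $m$-qubit register $e_i$ private to each $P_i$, all starting in $|0\rangle$. In the (semi-honest) LCM protocol $P_0$ applies $H^{\otimes u}$ to $h$ and bitwise CNOT from $h$ to $t$; then $P_0,\dots,P_{n-1}$ in turn receive $t$ and apply $|j\rangle_t|y\rangle_{e_i}\mapsto|j\rangle_t|y\oplus(j \bmod x_i)\rangle_{e_i}$; then $P_0$ applies bitwise CNOT from $h$ to $t$ again, measures $t$ (accepting only the outcome $0$), applies $\mathrm{QFT}^\dagger$ to $h$, and measures $h$ with outcome $k$. Write $\omega=e^{2\pi\imath/2^u}$, $[N]=\{0,\dots,N-1\}$, $\rho_a(Y)=2^{-u}\,|\{j\in[2^u]: j\bmod a=Y\}|$ and $w_Z(d)=4^{-u}\bigl|\sum_{j\in[2^u],\,j\bmod T=Z}\omega^{jd}\bigr|^2$. All measurements are in the computational basis. **Theorem.** For every party $P_i$ the following three attacks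 give no information beyond $x_i$ and the public output $T$. 1. *Direct measurement.* At any time at which $s\in\{0,\dots,n\}$ parties have applied their operation and before the second CNOT of $P_0$, measuring $h$, or measuring $t$, gives each $j\in[2^u]$ with probability $2^{-u}$, and, if $P_i$ is among those $s$ parties, measuring $e_i$ gives each $Y\in[2^m]$ with probability $\rho_{x_i}(Y)$. After the second CNOT, $t$ is $0$ with probability $1$, and the statements on $h$ and $e_i$ still hold. At the end (right before $h$ is measured, equivalently averaged over $k$) $e_i$ again has the distribution $\rho_{x_i}$, and the pair of outcomes $(k,Y)$ of $h$ and $e_i$ has probability $\sum_{Z\in[T],\,Z\bmod x_i=Y}w_Z(k)$. If $T\mid 2^u$, then $k$ is uniform on the $T$ multiples of $2^u/T$ in $[2^u]$, and, given any such $k$, $e_i$ takes each value $Y\in[x_i]$ with probability $1/x_i$. For all $Y\in[x_i]$, $|\rho_{x_i}(Y)-1/x_i|<2^{-u}$, and $\rho_{x_i}(Y)=1/x_i$ if $x_i\mid 2^u$. 2. *Inverse Fourier transform before period finding.* If at any time at which $s\in\{0,\dots,n\}$ parties have applied their operation and before the second CNOT, $\mathrm{QFT}^\dagger$ is applied to $h$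 (respectively to $t$), then measuring that register gives each $k\in[2^u]$ with probability $2^{-u}$. 3. *Copy, and Fourier transform after period finding.* Suppose that at any such time the content of $t$ is copied by bitwise CNOT to a further $u$-qubit register $c$ initially in $|0\rangle$, that everybody then proceeds as prescribed, and that, after $P_0$ has measured $h$ with outcome $k$, $\mathrm{QFT}$ is applied to $c$ and $c$ is measured. Then the measurement of $t$ gives $0$ with probability $1$; each $k\in[2^u]$ has probability $2^{-u}$; given $k$, the outcome of $c$ is $l\in[2^u]$ with probability $\sum_{Z\in[T]}w_Z(l-k)$, which, if $T\mid2^u$, is $1/T$ when $l\equiv k+r\,2^u/T \pmod{2^u}$ for some $r\in[T]$ and $0$ otherwise; and averaged over $k$ each $l\in[2^u]$ has probability $2^{-u}$. Moreover, whether or not $T$ divides $2^u$: for any two tuples of private inputs with the same $x_i$, the joint distributions of the outcomes of $h,t,c,e_i$ agree at every time before $P_0$'s transform of $h$ in (1), and in (2); and if the two tuples also have the same least common multiple, the joint distributions of these outcomes also agree at the end of period finding in (1) (before the measurement of $h$, and after it given any outcome $k$), and in (3) the distribution of $k$ and, given any $k$, the joint distribution of the outcomes of $h,t,c,e_i$ agree.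 -/

import Mathlib

namespace QLCM

open scoped BigOperators

/-! Registers.  The global system has an index register `h`, a travelling register `t`, a register
`c` used only by a party who copies the content of `t`, all of `u` qubits, and for each of the
`n` parties a private `m`-qubit register `e i`.  A `q`-qubit computational basis vector is labelled
by the integer in `Fin (2 ^ q)` whose binary digits are its bits. -/

/-- Labels of the computational basis: the values of `(h, t, c, (e i)_i)`. -/
abbrev Basis (n m u : ℕ) : Type :=
  Fin (2 ^ u) × Fin (2 ^ u) × Fin (2 ^ u) × (Fin n → Fin (2 ^ m))

variable {n m u : ℕ}

/-- The value of register `h`. -/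
abbrev regH (b : Basis n m u) : Fin (2 ^ u) := b.1
/-- The value of register `t`. -/
abbrev regT (b : Basis n m u) : Fin (2 ^ u) := b.2.1
/-- The value of register `c`. -/
abbrev regC (b : Basis n m u) : Fin (2 ^ u) := b.2.2.1
/-- The value of register `e i`. -/
abbrev regE (b : Basis n m u) (i : Fin n) : Fin (2 ^ m) := b.2.2.2 i

/-- A (pure) state, given by its amplitudes in the computational basis. -/
abbrev State (n m u : ℕ) : Type := Basis n m u → ℂ

/-- The computational basis vector with label `b`. -/
noncomputable def ket (b : Basis n m u) : State n m u := Pi.single b 1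

/-- The linear operator that sends the basis vector labelled `b` to the one labelled `g b`. -/
noncomputable def basisMap (g : Basis n m u → Basis n m u) (ψ : State n m u) : State n m u :=
  ∑ b, ψ b • ket (g b)

/-- The operator that acts as the matrix `A` on register `h` and as the identity elsewhere. -/
noncomputable def onH (A : Matrix (Fin (2 ^ u)) (Fin (2 ^ u)) ℂ) (ψ : State n m u) :
    State n m u :=
  fun b => ∑ y, A (regH b) y * ψ (y, regT b, regC b, regE b)

/-- The operator that acts as the matrix `A` on register `t` and as the identity elsewhere. -/
noncomputable def onT (A : Matrix (Fin (2 ^ u)) (Fin (2 ^ u)) ℂ) (ψ : State n m u) :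
    State n m u :=
  fun b => ∑ y, A (regT b) y * ψ (regH b, y, regC b, regE b)

/-- The operator that acts as the matrix `A` on register `c` and as the identity elsewhere. -/
noncomputable def onC (A : Matrix (Fin (2 ^ u)) (Fin (2 ^ u)) ℂ) (ψ : State n m u) :
    State n m u :=
  fun b => ∑ y, A (regC b) y * ψ (regH b, regT b, y, regE b)

/-! Elementary operators. -/

/-- Bitwise exclusive or of `q`-bit integers. -/
def xorBits {q : ℕ} (a b : Fin (2 ^ q)) : Fin (2 ^ q) :=
  ⟨a.val ^^^ b.val, Nat.xor_lt_two_pow a.isLt b.isLt⟩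

/-- The all-zero bit string. -/
def zeroBits (q : ℕ) : Fin (2 ^ q) := ⟨0, Nat.two_pow_pos q⟩

/-- The Hadamard gate on each of `u` qubits: the entry at `(j, x)` is `(-1) ^ (x · j)`, divided by
the square root of `2 ^ u`, with `x · j` the inner product of bit strings. -/
noncomputable def hadamard (u : ℕ) : Matrix (Fin (2 ^ u)) (Fin (2 ^ u)) ℂ :=
  Matrix.of fun j x =>
    (-1 : ℂ) ^ ((Finset.range u).filter
      (fun r => x.val.testBit r = true ∧ j.val.testBit r = true)).card
      / (Real.sqrt ((2 : ℝ) ^ u) : ℂ)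

/-- `exp (2 π i d / 2 ^ u)`. -/
noncomputable def phase (u : ℕ) (d : ℤ) : ℂ :=
  Complex.exp (2 * (Real.pi : ℂ) * Complex.I * (d : ℂ) / (2 : ℂ) ^ u)

/-- The quantum Fourier transform on `u` qubits. -/
noncomputable def qft (u : ℕ) : Matrix (Fin (2 ^ u)) (Fin (2 ^ u)) ℂ :=
  Matrix.of fun j x => phase u ((x.val : ℤ) * (j.val : ℤ)) / (Real.sqrt ((2 : ℝ) ^ u) : ℂ)

/-- The inverse quantum Fourier transform on `u` qubits. -/
noncomputable def qftInv (u : ℕ) : Matrix (Fin (2 ^ u)) (Fin (2 ^ u)) ℂ :=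
  Matrix.of fun j x => phase u (-((x.val : ℤ) * (j.val : ℤ))) / (Real.sqrt ((2 : ℝ) ^ u) : ℂ)

/-- Bitwise CNOT with control `h` and target `t`. -/
noncomputable def cnotHT : State n m u → State n m u :=
  basisMap fun b => (regH b, xorBits (regT b) (regH b), regC b, regE b)

/-- Bitwise CNOT with control `t` and target `c`: copies the label of `t` into a zeroed `c`. -/
noncomputable def cnotTC : State n m u → State n m u :=
  basisMap fun b => (regH b, regT b, xorBits (regC b) (regT b), regE b)

/-- The private function `j ↦ j mod a` of a party with input `a`, with `m`-bit values
(the outer reduction does nothing when `0 < a < 2 ^ m`). -/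
def residue (m u a : ℕ) (j : Fin (2 ^ u)) : Fin (2 ^ m) :=
  ⟨(j.val % a) % 2 ^ m, Nat.mod_lt _ (Nat.two_pow_pos m)⟩

/-- The oracle of party `i`: `|j⟩` in `t` and `|y⟩` in `e i` are sent to `|j⟩` and
`|y xor (j mod x i)⟩`. -/
noncomputable def oracle (x : Fin n → ℕ) (i : Fin n) : State n m u → State n m u :=
  basisMap fun b => (regH b, regT b, regC b,
    Function.update (regE b) i (xorBits (regE b i) (residue m u (x i) (regT b))))

/-! Measurements in the computational basis. -/

open Classical in
/-- Born rule: the probability that the measured label satisfies `P`. -/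
noncomputable def prob (ψ : State n m u) (P : Basis n m u → Prop) : ℝ :=
  ∑ b, if P b then ‖ψ b‖ ^ 2 else 0

open Classical in
/-- The normalized state after a measurement with outcome `P` (zero if the outcome has
probability zero). -/
noncomputable def collapse (P : Basis n m u → Prop) (ψ : State n m u) : State n m u :=
  fun b => if P b then ψ b / (Real.sqrt (prob ψ P) : ℂ) else 0

/-- The joint distribution of the outcomes of measuring `h`, `t`, `c` and the private register
`e i` of party `i`. -/
noncomputable def view (i : Fin n) (ψ : State n m u) (a b c : Fin (2 ^ u)) (Y : Fin (2 ^ m)) : ℝ :=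
  prob ψ fun w => regH w = a ∧ regT w = b ∧ regC w = c ∧ regE w i = Y

/-! The quantum part of the protocol with private inputs `x`. -/

/-- The state after party `0` has applied Hadamard gates to `h` and has copied `h` to `t`. -/
noncomputable def prepared : State n m u :=
  cnotHT (onH (hadamard u)
    (ket (zeroBits u, zeroBits u, zeroBits u, fun _ => zeroBits m)))

/-- Parties `s, s + 1, …, s + d - 1` (those below `n`) apply their oracles, in this order. -/
noncomputable def oraclesFrom (x : Fin n → ℕ) (s : ℕ) : ℕ → State n m u → State n m u
  | 0, ψ => ψ
  | d + 1, ψ =>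
    if hlt : s + d < n then oracle x ⟨s + d, hlt⟩ (oraclesFrom x s d ψ)
    else oraclesFrom x s d ψ

/-- The state when exactly the parties `0, …, s - 1` have applied their oracles. -/
noncomputable def stateAfter (x : Fin n → ℕ) (s : ℕ) : State n m u :=
  oraclesFrom x 0 s prepared

/-- Party `0`, having got `t` back, measures it after the second CNOT, accepts the outcome `0`,
and applies the inverse Fourier transform to `h`; the argument is the state after that CNOT. -/
noncomputable def checkAndTransform (ψ : State n m u) : State n m u :=
  onH (qftInv u) (collapse (fun b => regT b = zeroBits u) ψ)

/-- The state after the second CNOT of party `0`. -/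
noncomputable def uncomputed (x : Fin n → ℕ) : State n m u :=
  cnotHT (stateAfter x n)

/-- The state right before party `0` measures `h` to find the period. -/
noncomputable def final (x : Fin n → ℕ) : State n m u :=
  checkAndTransform (uncomputed x)

/-- The state after party `0` has measured `h` with outcome `k`. -/
noncomputable def afterPeriodFinding (x : Fin n → ℕ) (k : Fin (2 ^ u)) : State n m u :=
  collapse (fun b => regH b = k) (final x)

/-! The run in which an attacker copies `t` into `c` when parties `0, …, s - 1` have applied their
oracles; everybody then goes on as prescribed. -/

/-- The state after the second CNOT of party `0`, with a copy made at time `s`. -/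
noncomputable def uncomputedCopy (x : Fin n → ℕ) (s : ℕ) : State n m u :=
  cnotHT (oraclesFrom x s (n - s) (cnotTC (stateAfter x s)))

/-- The state right before party `0` measures `h`, with a copy made at time `s`. -/
noncomputable def finalCopy (x : Fin n → ℕ) (s : ℕ) : State n m u :=
  checkAndTransform (uncomputedCopy x s)

/-- The state after party `0` has found `k` in `h` and the attacker has then applied the Fourier
transform to the copy `c`. -/
noncomputable def attackedCopy (x : Fin n → ℕ) (s : ℕ) (k : Fin (2 ^ u)) : State n m u :=
  onC (qft u) (collapse (fun b => regH b = k) (finalCopy x s))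

/-! Explicit distributions. -/

/-- The number of `j < 2 ^ u` with `j mod a = Y`, divided by `2 ^ u`. -/
noncomputable def residueFreq (u a Y : ℕ) : ℝ :=
  (((Finset.range (2 ^ u)).filter (fun j => j % a = Y)).card : ℝ) / 2 ^ u

/-- The squared modulus of the sum of `exp (2 π i j d / 2 ^ u)` over `j < 2 ^ u` with
`j mod T = Z`, divided by `(2 ^ u) ^ 2`. -/
noncomputable def classWeight (u T Z : ℕ) (d : ℤ) : ℝ :=
  ‖∑ j ∈ (Finset.range (2 ^ u)).filter (fun j => j % T = Z), phase u ((j : ℤ) * d)‖ ^ 2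
    / (2 ^ u) ^ 2

end QLCM

/-! Before any Fourier transform every state of the protocol is a uniform superposition of distinct
basis vectors, one for each label `j` of `h`, so measuring a register counts labels, and a transform
of `h` or of `t` leaves the label recorded in the other register, so that no two labels interfere.
Once `t` has been uncomputed, the label survives only in the private registers, which by the Chinese
remainder theorem record exactly the class of `j` modulo `T = lcm x`. Hence the transform of `h`
(or, after a copy, the two transforms, whose phases combine to one at distance `l - k`) makes the
labels of each class interfere, with amplitudes that depend only on `u` and `T`. Their squared
moduli are geometric sums when `T ∣ 2 ^ u`, and Parseval's identity gives the averages over `k` in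
general. Views agree because the labels `(h, t, c, e i)` involve the inputs only through `x i`. -/

namespace QLCM

variable {n m u : ℕ}

section Phase

lemma sum_pow_of_pow_eq_one {R : Type*} [Ring R] [NoZeroDivisors R] [DecidableEq R] {r : R} {M : ℕ}
    (h : r ^ M = 1) : ∑ i ∈ Finset.range M, r ^ i = if r = 1 then (M : R) else 0 := by
  split_ifs with hr
  · simp [hr]
  · have := mul_neg_geom_sum r M
    rw [h, sub_self] at this
    exact (mul_eq_zero.1 this).resolve_left (sub_ne_zero.2 (Ne.symm hr))

lemma phase_eq_stdAddChar (u : ℕ) (d : ℤ) :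
    phase u d = ZMod.stdAddChar (d : ZMod (2 ^ u)) := by
  rw [ZMod.stdAddChar_coe, phase]
  push_cast
  rfl

lemma norm_phase (u : ℕ) (d : ℤ) : ‖phase u d‖ = 1 := by
  rw [phase_eq_stdAddChar, AddChar.norm_apply]

lemma phase_add (u : ℕ) (d e : ℤ) : phase u (d + e) = phase u d * phase u e := by
  simp only [phase_eq_stdAddChar, Int.cast_add, AddChar.map_add_eq_mul]

lemma phase_neg (u : ℕ) (d : ℤ) : phase u (-d) = starRingEnd ℂ (phase u d) := by
  simp only [phase_eq_stdAddChar, Int.cast_neg, AddChar.map_neg_eq_conj]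

lemma phase_natCast_mul (u r : ℕ) (d : ℤ) : phase u (r * d) = phase u d ^ r := by
  simp only [phase_eq_stdAddChar, ← AddChar.map_nsmul_eq_pow, nsmul_eq_mul, Int.cast_mul,
    Int.cast_natCast]

lemma phase_eq_one_iff (u : ℕ) (d : ℤ) : phase u d = 1 ↔ (2 : ℤ) ^ u ∣ d := by
  rw [phase_eq_stdAddChar, ← AddChar.map_zero_eq_one (ZMod.stdAddChar (N := 2 ^ u)),
    ZMod.injective_stdAddChar.eq_iff, ZMod.intCast_zmod_eq_zero_iff_dvd]
  push_cast
  rfl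

lemma sum_phase (u : ℕ) (d : ℤ) :
    ∑ k : Fin (2 ^ u), phase u (k.val * d) = if (2 : ℤ) ^ u ∣ d then (2 : ℂ) ^ u else 0 := by
  have hroot : phase u d ^ 2 ^ u = 1 := by
    rw [← phase_natCast_mul, phase_eq_one_iff]
    exact_mod_cast Dvd.intro d rfl
  simp only [phase_natCast_mul]
  rw [Fin.sum_univ_eq_sum_range (fun k => phase u d ^ k), sum_pow_of_pow_eq_one hroot]
  simp [phase_eq_one_iff]

lemma sum_phase_mul_conj_phase (y y' : Fin (2 ^ u)) :
    ∑ k : Fin (2 ^ u), phase u (y.val * k.val) * starRingEnd ℂ (phase u (y'.val * k.val)) =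
      if y = y' then (2 : ℂ) ^ u else 0 := by
  have hdvd : (2 : ℤ) ^ u ∣ (y.val : ℤ) - y'.val ↔ y = y' := by
    have h : (2 : ℤ) ^ u ∣ (y.val : ℤ) - y'.val ↔ y'.val ≡ y.val [MOD 2 ^ u] := by
      rw [Nat.modEq_iff_dvd, Nat.cast_pow, Nat.cast_ofNat]
    rw [h, Fin.ext_iff, eq_comm]
    exact ⟨fun h => h.eq_of_lt_of_lt y'.isLt y.isLt, fun h => h ▸ rfl⟩
  rw [← if_congr hdvd rfl rfl, ← sum_phase]
  refine Finset.sum_congr rfl fun k _ => ?_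
  rw [← phase_neg, ← phase_add]
  congr 1
  ring

lemma sum_norm_sq_fourier (a : Fin (2 ^ u) → ℂ) :
    ∑ k : Fin (2 ^ u), ‖∑ y, a y * phase u (y.val * k.val)‖ ^ 2 = 2 ^ u * ∑ y, ‖a y‖ ^ 2 := by
  have key : ∑ k : Fin (2 ^ u), (∑ y, a y * phase u (y.val * k.val)) *
      starRingEnd ℂ (∑ y, a y * phase u (y.val * k.val)) =
        2 ^ u * ∑ y, a y * starRingEnd ℂ (a y) := calc
    _ = ∑ y, ∑ y', a y * starRingEnd ℂ (a y') * ∑ k : Fin (2 ^ u),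
          phase u (y.val * k.val) * starRingEnd ℂ (phase u (y'.val * k.val)) := by
      simp only [map_sum, map_mul, Finset.sum_mul_sum]
      rw [Finset.sum_comm]
      refine Finset.sum_congr rfl fun y _ => ?_
      rw [Finset.sum_comm]
      simp only [Finset.mul_sum]
      exact Finset.sum_congr rfl fun y' _ => Finset.sum_congr rfl fun k _ => mul_mul_mul_comm ..
    _ = _ := by
      simp [sum_phase_mul_conj_phase, Finset.mul_sum, mul_comm]
  simp only [Complex.mul_conj'] at key
  exact_mod_cast key

end Phase

section Residues

lemma card_filter_mod_eq_ceil {a Y : ℕ} (hY : Y < a) (N : ℕ) :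
    (({j ∈ Finset.range N | j % a = Y}.card : ℕ) : ℤ) = ⌈((N : ℚ) - Y) / a⌉ := by
  have h := Nat.count_modEq_card_eq_ceil N (Nat.zero_lt_of_lt hY) Y
  simpa only [Nat.count_eq_card_filter_range, Nat.ModEq, Nat.mod_eq_of_lt hY] using h

lemma abs_card_filter_mod_sub_lt_one {a Y : ℕ} (hY : Y < a) (N : ℕ) :
    |({j ∈ Finset.range N | j % a = Y}.card : ℝ) - N / a| < 1 := by
  have ha : (0 : ℚ) < a := by exact_mod_cast Nat.zero_lt_of_lt hY
  have hY0 : (0 : ℚ) ≤ Y / a := by positivity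
  have hY1 : (Y : ℚ) / a < 1 := (div_lt_one ha).2 (by exact_mod_cast hY)
  have hceil : ({j ∈ Finset.range N | j % a = Y}.card : ℚ) = ⌈(N : ℚ) / a - Y / a⌉ := by
    rw [← sub_div, ← card_filter_mod_eq_ceil hY N, Int.cast_natCast]
  have h1 := Int.le_ceil ((N : ℚ) / a - Y / a)
  have h2 := Int.ceil_lt_add_one ((N : ℚ) / a - Y / a)
  have key : |({j ∈ Finset.range N | j % a = Y}.card : ℚ) - N / a| < 1 := by
    rw [hceil, abs_lt]
    constructor <;> linarith
  simpa using (Rat.cast_lt (K := ℝ)).2 key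

lemma card_filter_mod_of_dvd {a Y N : ℕ} (hY : Y < a) (h : a ∣ N) :
    {j ∈ Finset.range N | j % a = Y}.card = N / a := by
  have key := abs_card_filter_mod_sub_lt_one hY N
  have ha : (a : ℝ) ≠ 0 := by exact_mod_cast (Nat.zero_lt_of_lt hY).ne'
  rw [← Nat.cast_div h ha] at key
  have : |(({j ∈ Finset.range N | j % a = Y}.card : ℕ) : ℤ) - (N / a : ℕ)| < 1 := by
    exact_mod_cast key
  have := Int.abs_lt_one_iff.1 this
  omega

lemma abs_residueFreq_sub_lt {a Y : ℕ} (hY : Y < a) (u : ℕ) :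
    |residueFreq u a Y - 1 / a| < 1 / 2 ^ u := by
  have hpow : (0 : ℝ) < 2 ^ u := by positivity
  have h := abs_card_filter_mod_sub_lt_one hY (2 ^ u)
  push_cast at h
  have hscale : residueFreq u a Y - 1 / a =
      (({j ∈ Finset.range (2 ^ u) | j % a = Y}.card : ℝ) - 2 ^ u / a) / 2 ^ u := by
    rw [residueFreq]
    field_simp
  rw [hscale, abs_div, abs_of_pos hpow]
  exact div_lt_div_of_pos_right h hpow

lemma residueFreq_of_dvd {a Y : ℕ} (hY : Y < a) (h : a ∣ 2 ^ u) :
    residueFreq u a Y = 1 / a := by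
  have ha : (a : ℝ) ≠ 0 := by exact_mod_cast (Nat.zero_lt_of_lt hY).ne'
  rw [residueFreq, card_filter_mod_of_dvd hY h, Nat.cast_div h ha]
  push_cast
  field_simp

lemma residueFreq_eq_sum (u a Y : ℕ) :
    residueFreq u a Y = ∑ y : Fin (2 ^ u), if y.val % a = Y then (1 : ℝ) / 2 ^ u else 0 := by
  rw [Fin.sum_univ_eq_sum_range (fun j => if j % a = Y then (1 : ℝ) / 2 ^ u else 0),
    ← Finset.sum_filter, Finset.sum_const, residueFreq, nsmul_eq_mul, mul_one_div]

lemma sum_residueFreq {a T : ℕ} (hT : 0 < T) (h : a ∣ T) (u Y : ℕ) :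
    ∑ Z ∈ Finset.range T with Z % a = Y, residueFreq u T Z = residueFreq u a Y := by
  simp only [residueFreq_eq_sum]
  rw [Finset.sum_comm]
  simp [Nat.mod_lt _ hT, Nat.mod_mod_of_dvd _ h]

lemma sum_residueFreq_range {T : ℕ} (hT : 0 < T) (u : ℕ) :
    ∑ Z ∈ Finset.range T, residueFreq u T Z = 1 := by
  simpa [residueFreq, Nat.mod_one] using sum_residueFreq hT (one_dvd T) u 0

lemma sum_filter_mod_eq {A : Type*} [AddCommMonoid A] {T Z : ℕ} (hZ : Z < T) (M : ℕ)
    (f : ℕ → A) :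
    ∑ j ∈ Finset.range (T * M) with j % T = Z, f j = ∑ r ∈ Finset.range M, f (T * r + Z) := by
  have hT := Nat.zero_lt_of_lt hZ
  refine Finset.sum_nbij' (· / T) (T * · + Z) ?_ ?_ ?_ ?_ ?_
  · intro j hj
    exact Finset.mem_range.2 (Nat.div_lt_of_lt_mul (Finset.mem_range.1 (Finset.mem_filter.1 hj).1))
  · intro r hr
    have hr : T * (r + 1) ≤ T * M := Nat.mul_le_mul_left T (Finset.mem_range.1 hr)
    simp only [Finset.mem_filter, Finset.mem_range, Nat.mul_add_mod, Nat.mod_eq_of_lt hZ, and_true]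
    linarith
  · intro j hj
    rw [← (Finset.mem_filter.1 hj).2, Nat.div_add_mod]
  · intro r _
    rw [Nat.mul_add_div hT, Nat.div_eq_of_lt hZ, add_zero]
  · intro j hj
    rw [← (Finset.mem_filter.1 hj).2, Nat.div_add_mod]

lemma exists_lt_eq_add_mul_mod_iff {T M k l : ℕ} (hl : l < T * M) :
    (∃ r < T, l = (k + r * M) % (T * M)) ↔ (M : ℤ) ∣ (l : ℤ) - k := by
  have hM : M ∣ T * M := Dvd.intro_left T rfl
  rw [← Nat.modEq_iff_dvd]
  constructor
  · rintro ⟨r, -, rfl⟩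
    rw [Nat.ModEq, Nat.mod_mod_of_dvd _ hM, Nat.add_mul_mod_self_right]
  · intro h
    have hk : k ≤ l + T * M * k :=
      (Nat.le_mul_of_pos_left k (Nat.zero_lt_of_lt hl)).trans (Nat.le_add_left _ _)
    have hmod : k ≡ l + T * M * k [MOD M] :=
      h.trans (by rw [Nat.ModEq, mul_right_comm, Nat.add_mul_mod_self_right])
    obtain ⟨r, hr⟩ := (Nat.modEq_iff_dvd' hk).1 hmod
    refine ⟨r % T, Nat.mod_lt _ (Nat.pos_of_mul_pos_right (Nat.zero_lt_of_lt hl)), ?_⟩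
    calc l = (l + T * M * k) % (T * M) := by
          rw [Nat.add_mul_mod_self_left, Nat.mod_eq_of_lt hl]
      _ = (k + r * M) % (T * M) := by rw [mul_comm r, ← hr, Nat.add_sub_cancel' hk]
      _ = (k + r % T * M) % (T * M) := by
          rw [← Nat.mul_mod_mul_right, Nat.add_mod_mod]

end Residues

section ClassWeight

/-- The complex number whose squared modulus is `classWeight u T Z d`: the amplitude with which the
residue class of `Z` modulo `T` contributes to an outcome at distance `d` in period finding. -/
noncomputable def classAmplitude (u T Z : ℕ) (d : ℤ) : ℂ :=
  (∑ y : Fin (2 ^ u) with y.val % T = Z, phase u (y.val * d)) / 2 ^ u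

lemma norm_classAmplitude_sq (u T Z : ℕ) (d : ℤ) :
    ‖classAmplitude u T Z d‖ ^ 2 = classWeight u T Z d := by
  rw [classAmplitude, norm_div, div_pow, norm_pow, Complex.norm_ofNat, classWeight,
    Finset.sum_filter, Finset.sum_filter,
    Fin.sum_univ_eq_sum_range (fun j => if j % T = Z then phase u (j * d) else 0)]

lemma classWeight_neg (u T Z : ℕ) (d : ℤ) : classWeight u T Z (-d) = classWeight u T Z d := by
  simp only [classWeight, mul_neg, phase_neg, ← map_sum, RCLike.norm_conj]

lemma sum_classWeight_sub (u T Z : ℕ) (l : ℤ) :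
    ∑ k : Fin (2 ^ u), classWeight u T Z (k.val - l) = residueFreq u T Z := by
  have h := sum_norm_sq_fourier fun y : Fin (2 ^ u) =>
    if y.val % T = Z then phase u (-(y.val * l)) / 2 ^ u else 0
  have hamp : ∀ k : Fin (2 ^ u), (∑ y : Fin (2 ^ u),
      (if y.val % T = Z then phase u (-(y.val * l)) / 2 ^ u else 0) * phase u (y.val * k.val)) =
        classAmplitude u T Z (k.val - l) := by
    intro k
    simp only [ite_mul, zero_mul, ← Finset.sum_filter, classAmplitude, Finset.sum_div]
    refine Finset.sum_congr rfl fun y _ => ?_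
    rw [div_mul_eq_mul_div, ← phase_add]
    congr 2
    ring
  simp only [hamp, norm_classAmplitude_sq] at h
  rw [h, residueFreq_eq_sum, Finset.mul_sum]
  refine Finset.sum_congr rfl fun y _ => ?_
  split_ifs
  · rw [norm_div, norm_phase, norm_pow, Complex.norm_ofNat]
    field_simp
  · simp

lemma classWeight_of_dvd {T Z : ℕ} (hZ : Z < T) (h : T ∣ 2 ^ u) (d : ℤ) :
    classWeight u T Z d = if ((2 ^ u / T : ℕ) : ℤ) ∣ d then 1 / (T : ℝ) ^ 2 else 0 := by
  have hT : 0 < T := Nat.zero_lt_of_lt hZ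
  obtain ⟨M, hM⟩ := h
  have hM0 : M ≠ 0 := by
    rintro rfl
    exact (Nat.two_pow_pos u).ne' hM
  have hphase : ∀ r : ℕ, phase u ((T * r + Z : ℕ) * d) = phase u (Z * d) * phase u (T * d) ^ r := by
    intro r
    rw [← phase_natCast_mul, ← phase_add]
    congr 1
    push_cast
    ring
  have hMZ : (2 : ℤ) ^ u = T * M := by exact_mod_cast hM
  have hroot : phase u (T * d) ^ M = 1 := by
    rw [← phase_natCast_mul, phase_eq_one_iff, hMZ]
    exact ⟨d, by ring⟩
  have hone : phase u (T * d) = 1 ↔ (M : ℤ) ∣ d := by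
    rw [phase_eq_one_iff, hMZ]
    exact mul_dvd_mul_iff_left (by exact_mod_cast hT.ne')
  have hMR : (2 : ℝ) ^ u = T * M := by exact_mod_cast hM
  rw [classWeight, hMR, hM, sum_filter_mod_eq hZ, Nat.mul_div_cancel_left _ hT]
  simp only [hphase, ← Finset.mul_sum, sum_pow_of_pow_eq_one hroot, hone, norm_mul, norm_phase,
    one_mul]
  split_ifs
  · rw [Complex.norm_natCast]
    field_simp
  · simp

lemma sum_classWeight_filter_of_dvd {a T Y : ℕ} (hT : 0 < T) (ha : a ∣ T) (hY : Y < a)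
    (h : T ∣ 2 ^ u) (d : ℤ) :
    ∑ Z ∈ Finset.range T with Z % a = Y, classWeight u T Z d =
      if ((2 ^ u / T : ℕ) : ℤ) ∣ d then 1 / (T : ℝ) * (1 / a) else 0 := by
  have ha0 : (a : ℝ) ≠ 0 := by exact_mod_cast (Nat.zero_lt_of_lt hY).ne'
  rw [Finset.sum_congr rfl fun Z hZ =>
    classWeight_of_dvd (Finset.mem_range.1 (Finset.mem_filter.1 hZ).1) h d, Finset.sum_const,
    card_filter_mod_of_dvd hY ha, nsmul_eq_mul, mul_ite, mul_zero, Nat.cast_div ha ha0]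
  congr 1
  field_simp

lemma sum_classWeight_range_of_dvd {T : ℕ} (hT : 0 < T) (h : T ∣ 2 ^ u) (d : ℤ) :
    ∑ Z ∈ Finset.range T, classWeight u T Z d =
      if ((2 ^ u / T : ℕ) : ℤ) ∣ d then 1 / (T : ℝ) else 0 := by
  simpa [Nat.mod_one] using sum_classWeight_filter_of_dvd hT (one_dvd T) one_pos h d

end ClassWeight

section Superposition

variable {ι κ ι' : Type*} [Fintype ι] [Fintype κ] [Fintype ι']

/-- The superposition of the basis vectors labelled `g p` with amplitudes `α p`. Every state of the
protocol is written in this form, where `g` need not be injective. -/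
noncomputable def superpose (α : ι → ℂ) (g : ι → Basis n m u) : State n m u :=
  ∑ p, α p • ket (g p)

lemma superpose_apply (α : ι → ℂ) (g : ι → Basis n m u) (b : Basis n m u) :
    superpose α g b = ∑ p, if g p = b then α p else 0 := by
  simp [superpose, ket, Pi.single_apply, eq_comm]

lemma superpose_apply_of_injective {g : ι → Basis n m u} (hg : Function.Injective g) (α : ι → ℂ)
    (p : ι) : superpose α g (g p) = α p := by
  classical
  simp [superpose_apply, hg.eq_iff]

lemma superpose_apply_of_notMem_range {g : ι → Basis n m u} {b : Basis n m u}
    (hb : b ∉ Set.range g) (α : ι → ℂ) : superpose α g b = 0 := by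
  rw [superpose_apply]
  exact Finset.sum_eq_zero fun p _ => if_neg fun h => hb ⟨p, h⟩

lemma superpose_prod_comp (α : κ × ι → ℂ) [DecidableEq ι'] (f : ι → ι')
    (g : κ × ι' → Basis n m u) :
    superpose α (fun p => g (p.1, f p.2)) =
      superpose (fun q : κ × ι' => ∑ y with f y = q.2, α (q.1, y)) g := by
  simp only [superpose, Fintype.sum_prod_type, Finset.sum_smul]
  refine Finset.sum_congr rfl fun k _ => ?_
  rw [← Finset.sum_fiberwise Finset.univ f]
  refine Finset.sum_congr rfl fun z _ => Finset.sum_congr rfl fun y hy => ?_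
  rw [(Finset.mem_filter.1 hy).2]

lemma basisMap_superpose (f : Basis n m u → Basis n m u) (α : ι → ℂ) (g : ι → Basis n m u) :
    basisMap f (superpose α g) = superpose α (fun p => f (g p)) := by
  simp only [basisMap, superpose_apply, Finset.sum_smul, ite_smul, zero_smul]
  rw [Finset.sum_comm]
  simp [superpose]

end Superposition

section Measurement

variable {ι κ : Type*} [Fintype ι] [Fintype κ]

lemma prob_nonneg (ψ : State n m u) (P : Basis n m u → Prop) : 0 ≤ prob ψ P := by
  classical
  exact Finset.sum_nonneg fun b _ => by split_ifs <;> positivity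

lemma prob_eq_sum_prob_and (f : Basis n m u → κ) (ψ : State n m u)
    (P : Basis n m u → Prop) : prob ψ P = ∑ k, prob ψ fun b => f b = k ∧ P b := by
  classical
  unfold prob
  rw [Finset.sum_comm]
  refine Finset.sum_congr rfl fun b _ => ?_
  by_cases hb : P b <;> simp [hb]

lemma prob_superpose {g : ι → Basis n m u} (hg : Function.Injective g) (α : ι → ℂ)
    (P : Basis n m u → Prop) [DecidablePred P] :
    prob (superpose α g) P = ∑ p, if P (g p) then ‖α p‖ ^ 2 else 0 := by
  refine (Fintype.sum_of_injective g hg _ _ (fun b hb => ?_) fun p => ?_).symm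
  · simp [superpose_apply_of_notMem_range hb]
  · rw [superpose_apply_of_injective hg]
    congr

lemma collapse_eq_self {ψ : State n m u} {P : Basis n m u → Prop} (h : ∀ b, ψ b ≠ 0 → P b)
    (hP : prob ψ P = 1) : collapse P ψ = ψ := by
  funext b
  by_cases hb : P b
  · simp [collapse, hb, hP]
  · simp [collapse, hb, not_imp_comm.1 (h b) hb]

lemma prob_collapse (ψ : State n m u) (P Q : Basis n m u → Prop) :
    prob (collapse Q ψ) P = prob ψ (fun b => Q b ∧ P b) / prob ψ Q := by
  classical
  have hnorm : ‖((√(prob ψ Q) : ℝ) : ℂ)‖ ^ 2 = prob ψ Q := by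
    rw [Complex.norm_real, Real.norm_of_nonneg (Real.sqrt_nonneg _), Real.sq_sqrt (prob_nonneg ψ Q)]
  rw [prob, prob.eq_1 ψ fun b => Q b ∧ P b, Finset.sum_div]
  refine Finset.sum_congr rfl fun b _ => ?_
  by_cases hQ : Q b
  · simp only [collapse, hQ, if_true, norm_div, div_pow, hnorm, ite_div, zero_div]
    exact if_congr (and_iff_right trivial).symm rfl rfl
  · simp [collapse, hQ]

lemma collapse_superpose_prod {P : Basis n m u → Prop} {g : κ × ι → Basis n m u} {k : κ}
    (hP : ∀ p, P (g p) ↔ p.1 = k) (α : κ × ι → ℂ) :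
    collapse P (superpose α g) =
      superpose (fun y => α (k, y) / (√(prob (superpose α g) P) : ℝ)) fun y => g (k, y) := by
  funext b
  rw [collapse, superpose_apply _ fun y => g (k, y)]
  split_ifs with hb
  · rw [superpose_apply, Fintype.sum_prod_type, Finset.sum_eq_single k, Finset.sum_div]
    · simp only [ite_div, zero_div]
    · intro k' _ hk'
      refine Finset.sum_eq_zero fun y _ => if_neg fun h => hk' ?_
      exact (hP (k', y)).1 (h ▸ hb)
    · simp
  · refine (Finset.sum_eq_zero fun y _ => if_neg fun h => hb ?_).symm
    exact h ▸ (hP (k, y)).2 rfl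

lemma view_superpose_congr {i : Fin n} {g g' : ι → Basis n m u} (hg : Function.Injective g)
    (hg' : Function.Injective g')
    (h : ∀ p, (regH (g p), regT (g p), regC (g p), regE (g p) i) =
      (regH (g' p), regT (g' p), regC (g' p), regE (g' p) i)) (α : ι → ℂ) :
    view i (superpose α g) = view i (superpose α g') := by
  funext a b c Y
  simp only [Prod.mk.injEq] at h
  simp only [view, prob_superpose hg, prob_superpose hg', h]

end Measurement

section Register

/-- A `u`-qubit register of the global system, given by how its value is read and overwritten in a
basis label. It lets `h`, `t` and `c` be treated alike. -/
structure Register (n m u : ℕ) where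
  get : Basis n m u → Fin (2 ^ u)
  set : Fin (2 ^ u) → Basis n m u → Basis n m u
  get_set : ∀ y b, get (set y b) = y
  set_get : ∀ b, set (get b) b = b
  set_set : ∀ y y' b, set y (set y' b) = set y b

namespace Register

/-- The register `h`. -/
def h : Register n m u where
  get := regH
  set y b := (y, regT b, regC b, regE b)
  get_set _ _ := rfl
  set_get _ := rfl
  set_set _ _ _ := rfl

/-- The register `t`. -/
def t : Register n m u where
  get := regT
  set y b := (regH b, y, regC b, regE b)
  get_set _ _ := rfl
  set_get _ := rfl
  set_set _ _ _ := rfl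

/-- The register `c`. -/
def c : Register n m u where
  get := regC
  set y b := (regH b, regT b, y, regE b)
  get_set _ _ := rfl
  set_get _ := rfl
  set_set _ _ _ := rfl

/-- The operator that acts as the matrix `A` on the register and as the identity elsewhere. -/
noncomputable def apply (R : Register n m u) (A : Matrix (Fin (2 ^ u)) (Fin (2 ^ u)) ℂ) :
    State n m u →ₗ[ℂ] State n m u where
  toFun ψ b := ∑ y, A (R.get b) y * ψ (R.set y b)
  map_add' ψ φ := by
    funext b
    simp [mul_add, Finset.sum_add_distrib]
  map_smul' a ψ := by
    funext b
    simp [Finset.mul_sum, mul_left_comm]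

lemma set_eq_iff (R : Register n m u) {y : Fin (2 ^ u)} {b b' : Basis n m u} :
    R.set y b = b' ↔ y = R.get b' ∧ R.set (R.get b) b' = b := by
  constructor
  · rintro rfl
    exact ⟨(R.get_set y b).symm, by rw [R.set_set, R.set_get]⟩
  · rintro ⟨rfl, hb⟩
    rw [← hb, R.set_set, R.set_get]

lemma apply_ket (R : Register n m u) (A : Matrix (Fin (2 ^ u)) (Fin (2 ^ u)) ℂ)
    (b : Basis n m u) :
    R.apply A (ket b) = superpose (fun y => A y (R.get b)) fun y => R.set y b := by
  funext b'
  change ∑ y, A (R.get b') y * ket b (R.set y b') = _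
  rw [Fintype.sum_eq_single (R.get b), superpose_apply, Fintype.sum_eq_single (R.get b')]
  · rw [ket, Pi.single_apply, mul_ite, mul_one, mul_zero]
    exact if_congr ⟨fun h => R.set_eq_iff.2 ⟨rfl, h⟩, fun h => (R.set_eq_iff.1 h).2⟩ rfl rfl
  · intro y hy
    exact if_neg fun h => hy (R.set_eq_iff.1 h).1
  · intro y hy
    rw [ket, Pi.single_eq_of_ne fun h => hy (R.set_eq_iff.1 h).1, mul_zero]

variable {ι : Type*} [Fintype ι]

lemma apply_superpose (R : Register n m u) (A : Matrix (Fin (2 ^ u)) (Fin (2 ^ u)) ℂ)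
    (α : ι → ℂ) (g : ι → Basis n m u) :
    R.apply A (superpose α g) =
      superpose (fun p : Fin (2 ^ u) × ι => A p.1 (R.get (g p.2)) * α p.2)
        fun p => R.set p.1 (g p.2) := by
  rw [superpose, map_sum, superpose, Fintype.sum_prod_type_right]
  simp only [map_smul, apply_ket, superpose, Finset.smul_sum, smul_smul, mul_comm]

end Register

end Register

section Amplitudes

/-- The amplitude of each label in a uniform superposition of `2 ^ u` labels. -/
noncomputable def uniformAmplitude (u : ℕ) : ℂ :=
  1 / (√((2 : ℝ) ^ u) : ℝ)

lemma ofReal_sqrt_two_pow_mul_self (u : ℕ) :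
    (√((2 : ℝ) ^ u) : ℂ) * (√((2 : ℝ) ^ u) : ℂ) = 2 ^ u := by
  rw [← Complex.ofReal_mul, Real.mul_self_sqrt (by positivity)]
  push_cast
  rfl

lemma norm_uniformAmplitude_sq (u : ℕ) : ‖uniformAmplitude u‖ ^ 2 = 1 / 2 ^ u := by
  rw [uniformAmplitude, norm_div, norm_one, Complex.norm_real,
    Real.norm_of_nonneg (Real.sqrt_nonneg _), div_pow, one_pow, Real.sq_sqrt (by positivity)]

lemma ofReal_sqrt_one_div_two_pow (u : ℕ) :
    ((√((1 : ℝ) / 2 ^ u) : ℝ) : ℂ) = uniformAmplitude u := by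
  rw [uniformAmplitude, Real.sqrt_div zero_le_one, Real.sqrt_one, Complex.ofReal_div,
    Complex.ofReal_one]

lemma uniformAmplitude_ne_zero (u : ℕ) : uniformAmplitude u ≠ 0 := by
  rw [← ofReal_sqrt_one_div_two_pow, Complex.ofReal_ne_zero]
  positivity

lemma hadamard_zeroBits (j : Fin (2 ^ u)) : hadamard u j (zeroBits u) = uniformAmplitude u := by
  simp [hadamard, zeroBits, uniformAmplitude]

lemma qftInv_mul_uniformAmplitude (k y : Fin (2 ^ u)) :
    qftInv u k y * uniformAmplitude u = phase u (y.val * -k.val) / 2 ^ u := by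
  rw [qftInv, Matrix.of_apply, uniformAmplitude, div_mul_div_comm, mul_one,
    ofReal_sqrt_two_pow_mul_self, mul_neg]

lemma qft_mul_qftInv (l y k : Fin (2 ^ u)) :
    qft u l y * qftInv u k y = phase u (y.val * (l.val - k.val)) / 2 ^ u := by
  rw [qft, qftInv, Matrix.of_apply, Matrix.of_apply, div_mul_div_comm,
    ofReal_sqrt_two_pow_mul_self, ← phase_add]
  congr 2
  ring

lemma norm_qftInv_mul_uniformAmplitude_sq (k y : Fin (2 ^ u)) :
    ‖qftInv u k y * uniformAmplitude u‖ ^ 2 = 1 / 2 ^ u * (1 / 2 ^ u) := by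
  rw [qftInv_mul_uniformAmplitude, norm_div, norm_phase, norm_pow, Complex.norm_ofNat]
  ring

end Amplitudes

section UniformSuperposition

variable {g : Fin (2 ^ u) → Basis n m u}

lemma prob_uniform (hg : Function.Injective g) (P : Basis n m u → Prop) [DecidablePred P] :
    prob (superpose (fun _ => uniformAmplitude u) g) P =
      ∑ y, if P (g y) then (1 : ℝ) / 2 ^ u else 0 := by
  simp only [prob_superpose hg, norm_uniformAmplitude_sq]

lemma prob_uniform_of_forall (hg : Function.Injective g) {P : Basis n m u → Prop}
    (hP : ∀ y, P (g y)) : prob (superpose (fun _ => uniformAmplitude u) g) P = 1 := by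
  classical
  simp [prob_uniform hg, hP]

lemma Register.prob_get_uniform (R : Register n m u) (hg : ∀ y, R.get (g y) = y)
    (j : Fin (2 ^ u)) :
    prob (superpose (fun _ => uniformAmplitude u) g) (fun b => R.get b = j) = 1 / 2 ^ u := by
  simp [prob_uniform (Function.LeftInverse.injective hg), hg]

lemma Register.prob_get_qftInv (R : Register n m u)
    (hg : Function.Injective fun p : Fin (2 ^ u) × Fin (2 ^ u) => R.set p.1 (g p.2))
    (hget : ∀ y, R.get (g y) = y) (k : Fin (2 ^ u)) :
    prob (R.apply (qftInv u) (superpose (fun _ => uniformAmplitude u) g)) (fun b => R.get b = k) =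
      1 / 2 ^ u := by
  simp only [apply_superpose, prob_superpose hg, hget, norm_qftInv_mul_uniformAmplitude_sq,
    R.get_set, Fintype.sum_prod_type_right]
  simp

lemma checkAndTransform_uniform (hg : Function.Injective g) (ht : ∀ y, regT (g y) = zeroBits u) :
    checkAndTransform (superpose (fun _ => uniformAmplitude u) g) =
      Register.h.apply (qftInv u) (superpose (fun _ => uniformAmplitude u) g) := by
  rw [checkAndTransform, collapse_eq_self _ (prob_uniform_of_forall hg ht)]
  · rfl
  · intro b hb
    by_contra h
    exact hb (superpose_apply_of_notMem_range (by rintro ⟨y, rfl⟩; exact h (ht y)) _)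

end UniformSuperposition

section Memory

/-- The content of the private registers once the parties `0, …, s - 1` have applied their oracles
to the label `j` of `t`. -/
def memory (m : ℕ) (x : Fin n → ℕ) (s j : ℕ) : Fin n → Fin (2 ^ m) := fun k =>
  if k.val < s then ⟨j % x k % 2 ^ m, Nat.mod_lt _ (Nat.two_pow_pos m)⟩ else zeroBits m

lemma memory_apply_eq_iff {x : Fin n → ℕ} {k : Fin n} {s : ℕ} (hk : k.val < s)
    (hx : 0 < x k ∧ x k < 2 ^ m) (j : ℕ) (Y : Fin (2 ^ m)) :
    memory m x s j k = Y ↔ j % x k = Y.val := by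
  simp only [memory, hk, if_true, Fin.ext_iff, Nat.mod_eq_of_lt ((Nat.mod_lt j hx.1).trans hx.2)]

lemma memory_apply_congr {x x' : Fin n → ℕ} {k : Fin n} (h : x' k = x k) (s j : ℕ) :
    memory m x' s j k = memory m x s j k := by
  simp only [memory, h]

lemma modEq_lcm_iff {ι : Type*} (S : Finset ι) (x : ι → ℕ) (a b : ℕ) :
    a ≡ b [MOD S.lcm x] ↔ ∀ k ∈ S, a ≡ b [MOD x k] := by
  simp only [Nat.modEq_iff_dvd, Int.natCast_dvd, Finset.lcm_dvd_iff]

lemma memory_eq_iff {x : Fin n → ℕ} (hx : ∀ k, 0 < x k ∧ x k < 2 ^ m) (Z Z' : ℕ) :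
    memory m x n Z = memory m x n Z' ↔ Z ≡ Z' [MOD Finset.univ.lcm x] := by
  rw [modEq_lcm_iff, funext_iff]
  refine forall_congr' fun k => ?_
  rw [eq_comm, memory_apply_eq_iff k.isLt (hx k)]
  simp [memory, Nat.ModEq, Nat.mod_eq_of_lt ((Nat.mod_lt _ (hx k).1).trans (hx k).2), eq_comm]

lemma xorBits_self {q : ℕ} (a : Fin (2 ^ q)) : xorBits a a = zeroBits q :=
  Fin.ext (Nat.xor_self a.val)

lemma xorBits_zeroBits_left {q : ℕ} (a : Fin (2 ^ q)) : xorBits (zeroBits q) a = a :=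
  Fin.ext (Nat.zero_xor a.val)

lemma update_memory (x : Fin n → ℕ) {s : ℕ} (hs : s < n) (y : Fin (2 ^ u)) :
    Function.update (memory m x s y) ⟨s, hs⟩
      (xorBits (memory m x s y ⟨s, hs⟩) (residue m u (x ⟨s, hs⟩) y)) = memory m x (s + 1) y := by
  funext k
  rcases eq_or_ne k ⟨s, hs⟩ with rfl | hk
  · simp [memory, residue, xorBits_zeroBits_left]
  · have hks : k.val ≠ s := fun h => hk (Fin.ext h)
    have hlt : k.val < s + 1 ↔ k.val < s := by omega
    simp only [Function.update_of_ne hk, memory, hlt]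

lemma memory_of_le (x : Fin n → ℕ) {s : ℕ} (hs : n ≤ s) (j : ℕ) :
    memory m x s j = memory m x n j := by
  funext k
  simp only [memory, k.isLt, k.isLt.trans_le hs]

end Memory

section Protocol

lemma oraclesFrom_superpose {ι : Type*} [Fintype ι] (x : Fin n → ℕ) (s d : ℕ) (α : ι → ℂ)
    (h t c : ι → Fin (2 ^ u)) :
    oraclesFrom x s d (superpose α fun p => (h p, t p, c p, memory m x s (t p))) =
      superpose α fun p => (h p, t p, c p, memory m x (s + d) (t p)) := by
  induction d with
  | zero => rfl
  | succ d ih =>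
    rw [oraclesFrom, ih, ← add_assoc]
    split_ifs with hlt
    · rw [oracle, basisMap_superpose]
      simp only [← update_memory x hlt]
    · have hle : n ≤ s + d := not_lt.1 hlt
      simp only [memory_of_le x hle, memory_of_le x (hle.trans (Nat.le_succ _))]

lemma prepared_eq :
    prepared (n := n) (m := m) = superpose (fun _ => uniformAmplitude u) fun y : Fin (2 ^ u) =>
      (y, y, zeroBits u, fun _ => zeroBits m) := by
  change cnotHT (Register.h.apply (hadamard u) _) = _
  simp only [Register.apply_ket, cnotHT, basisMap_superpose, Register.h, hadamard_zeroBits, regH,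
    regT, regC, xorBits_zeroBits_left]

lemma stateAfter_eq (x : Fin n → ℕ) (s : ℕ) :
    stateAfter x s = superpose (fun _ => uniformAmplitude u) fun y : Fin (2 ^ u) =>
      (y, y, zeroBits u, memory m x s y) := by
  have h := oraclesFrom_superpose (m := m) x 0 s (fun _ => uniformAmplitude u) (fun y => y)
    (fun y => y) fun _ => zeroBits u
  rw [zero_add] at h
  rw [stateAfter, prepared_eq, ← h]
  rfl

lemma uncomputed_eq (x : Fin n → ℕ) :
    uncomputed x = superpose (fun _ => uniformAmplitude u) fun y : Fin (2 ^ u) =>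
      (y, zeroBits u, zeroBits u, memory m x n y) := by
  simp only [uncomputed, stateAfter_eq, cnotHT, basisMap_superpose, regH, regT, regC, xorBits_self]

lemma uncomputedCopy_eq (x : Fin n → ℕ) {s : ℕ} (hs : s ≤ n) :
    uncomputedCopy x s = superpose (fun _ => uniformAmplitude u) fun y : Fin (2 ^ u) =>
      (y, zeroBits u, y, memory m x n y) := by
  simp only [uncomputedCopy, stateAfter_eq, cnotTC, cnotHT, basisMap_superpose, regH, regT, regC,
    xorBits_self, xorBits_zeroBits_left, oraclesFrom_superpose, Nat.add_sub_cancel' hs]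

end Protocol

section Transform

lemma onH_qftInv_stateAfter_eq (x : Fin n → ℕ) (s : ℕ) :
    onH (qftInv u) (stateAfter (m := m) x s) =
      superpose (fun p : Fin (2 ^ u) × Fin (2 ^ u) => qftInv u p.1 p.2 * uniformAmplitude u)
        fun p => (p.1, p.2, zeroBits u, memory m x s p.2) := by
  rw [stateAfter_eq]
  exact Register.h.apply_superpose _ _ _

lemma onT_qftInv_stateAfter_eq (x : Fin n → ℕ) (s : ℕ) :
    onT (qftInv u) (stateAfter (m := m) x s) =
      superpose (fun p : Fin (2 ^ u) × Fin (2 ^ u) => qftInv u p.1 p.2 * uniformAmplitude u)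
        fun p => (p.2, p.1, zeroBits u, memory m x s p.2) := by
  rw [stateAfter_eq]
  exact Register.t.apply_superpose _ _ _

lemma finalCopy_eq (x : Fin n → ℕ) {s : ℕ} (hs : s ≤ n) :
    finalCopy x s =
      superpose (fun p : Fin (2 ^ u) × Fin (2 ^ u) => qftInv u p.1 p.2 * uniformAmplitude u)
        fun p => (p.1, zeroBits u, p.2, memory m x n p.2) := by
  rw [finalCopy, uncomputedCopy_eq x hs,
    checkAndTransform_uniform (fun _ _ h => congrArg regH h) fun _ => rfl]
  exact Register.h.apply_superpose _ _ _

lemma prob_regH_finalCopy (x : Fin n → ℕ) {s : ℕ} (hs : s ≤ n) (k : Fin (2 ^ u)) :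
    prob (finalCopy (m := m) x s) (fun w => regH w = k) = 1 / 2 ^ u := by
  rw [finalCopy, uncomputedCopy_eq x hs,
    checkAndTransform_uniform (fun _ _ h => congrArg regH h) fun _ => rfl]
  exact Register.h.prob_get_qftInv (g := fun y => (y, zeroBits u, y, memory m x n y))
    (fun _ _ h => Prod.ext (congrArg regH h) (congrArg regC h)) (fun _ => rfl) k

end Transform

section PeriodFinding

variable {x : Fin n → ℕ} {T : ℕ}

lemma lcm_pos (hx : ∀ k, 0 < x k) : 0 < Finset.univ.lcm x :=
  Nat.pos_of_ne_zero fun h => by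
    obtain ⟨k, -, hk⟩ := Finset.lcm_eq_zero_iff.1 h
    exact (hx k).ne' hk

lemma memory_injective (hx : ∀ k, 0 < x k ∧ x k < 2 ^ m) (hT : T = Finset.univ.lcm x) :
    Function.Injective fun Z : Fin T => memory m x n Z := by
  intro Z Z' h
  have hmod := (memory_eq_iff hx Z Z').1 h
  rw [← hT] at hmod
  exact Fin.ext (hmod.eq_of_lt_of_lt Z.isLt Z'.isLt)

-- The content of the private registers determines, and is determined by, the class of the label
-- modulo `T`, so exactly the labels of one class interfere.
lemma superpose_memory_eq {κ : Type*} [Fintype κ] (hx : ∀ k, 0 < x k ∧ x k < 2 ^ m)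
    (hT : T = Finset.univ.lcm x) (d : κ → ℤ) (h t c : κ → Fin (2 ^ u)) :
    superpose (fun p : κ × Fin (2 ^ u) => phase u (p.2.val * d p.1) / 2 ^ u)
        (fun p => (h p.1, t p.1, c p.1, memory m x n p.2)) =
      superpose (fun p : κ × Fin T => classAmplitude u T p.2 (d p.1))
        fun p => (h p.1, t p.1, c p.1, memory m x n p.2) := by
  have hTpos : 0 < T := hT ▸ lcm_pos fun k => (hx k).1
  let f : Fin (2 ^ u) → Fin T := fun y => ⟨y % T, Nat.mod_lt _ hTpos⟩
  let g : κ × Fin T → Basis n m u := fun p => (h p.1, t p.1, c p.1, memory m x n p.2)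
  have hlabel : (fun p : κ × Fin (2 ^ u) => (h p.1, t p.1, c p.1, memory m x n p.2)) =
      fun p => g (p.1, f p.2) := by
    funext p
    have hmod : memory m x n (p.2 % T) = memory m x n p.2 :=
      (memory_eq_iff hx _ _).2 (hT ▸ Nat.mod_modEq p.2 T)
    simp only [g, f, hmod]
  rw [hlabel, superpose_prod_comp]
  simp only [classAmplitude, f, Fin.ext_iff, Finset.sum_div]
  rfl

lemma final_eq (hx : ∀ k, 0 < x k ∧ x k < 2 ^ m) (hT : T = Finset.univ.lcm x) :
    final x = superpose (fun p : Fin (2 ^ u) × Fin T => classAmplitude u T p.2 (-p.1.val))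
      fun p => (p.1, zeroBits u, zeroBits u, memory m x n p.2) := by
  rw [final, uncomputed_eq, checkAndTransform_uniform (fun _ _ h => congrArg regH h) fun _ => rfl,
    Register.apply_superpose, ← superpose_memory_eq hx hT (fun k : Fin (2 ^ u) => -(k.val : ℤ))
      (fun k => k) (fun _ => zeroBits u) fun _ => zeroBits u]
  simp only [← qftInv_mul_uniformAmplitude]
  rfl

lemma collapse_finalCopy_eq (x : Fin n → ℕ) {s : ℕ} (hs : s ≤ n) (k : Fin (2 ^ u)) :
    collapse (fun b => regH b = k) (finalCopy (m := m) x s) =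
      superpose (fun y => qftInv u k y) fun y => (k, zeroBits u, y, memory m x n y) := by
  have hk := prob_regH_finalCopy (m := m) x hs k
  rw [finalCopy_eq x hs] at hk ⊢
  rw [collapse_superpose_prod fun _ => Iff.rfl, hk]
  simp only [ofReal_sqrt_one_div_two_pow, mul_div_cancel_right₀ _ (uniformAmplitude_ne_zero u)]

lemma attackedCopy_eq (hx : ∀ k, 0 < x k ∧ x k < 2 ^ m) (hT : T = Finset.univ.lcm x) {s : ℕ}
    (hs : s ≤ n) (k : Fin (2 ^ u)) :
    attackedCopy x s k =
      superpose (fun p : Fin (2 ^ u) × Fin T => classAmplitude u T p.2 (p.1.val - k.val))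
        fun p => (k, zeroBits u, p.1, memory m x n p.2) := by
  rw [attackedCopy, collapse_finalCopy_eq x hs, ← superpose_memory_eq hx hT
    (fun l : Fin (2 ^ u) => (l.val : ℤ) - k.val) (fun _ => k) (fun _ => zeroBits u) fun l => l]
  simp only [← qft_mul_qftInv]
  exact Register.c.apply_superpose _ _ _

lemma injective_final_label (hx : ∀ k, 0 < x k ∧ x k < 2 ^ m) (hT : T = Finset.univ.lcm x) :
    Function.Injective fun p : Fin (2 ^ u) × Fin T =>
      ((p.1, zeroBits u, zeroBits u, memory m x n p.2) : Basis n m u) :=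
  fun _ _ h => Prod.ext (congrArg regH h) (memory_injective hx hT (congrArg regE h))

lemma injective_attackedCopy_label (hx : ∀ k, 0 < x k ∧ x k < 2 ^ m)
    (hT : T = Finset.univ.lcm x) (k : Fin (2 ^ u)) :
    Function.Injective fun p : Fin (2 ^ u) × Fin T =>
      ((k, zeroBits u, p.1, memory m x n p.2) : Basis n m u) :=
  fun _ _ h => Prod.ext (congrArg regC h) (memory_injective hx hT (congrArg regE h))

end PeriodFinding

section Distributions

variable {x : Fin n → ℕ} {T : ℕ}

lemma prob_regH_stateAfter (x : Fin n → ℕ) (s : ℕ) (j : Fin (2 ^ u)) :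
    prob (stateAfter (m := m) x s) (fun w => regH w = j) = 1 / 2 ^ u := by
  rw [stateAfter_eq]
  exact Register.h.prob_get_uniform (fun _ => rfl) j

lemma prob_regT_stateAfter (x : Fin n → ℕ) (s : ℕ) (j : Fin (2 ^ u)) :
    prob (stateAfter (m := m) x s) (fun w => regT w = j) = 1 / 2 ^ u := by
  rw [stateAfter_eq]
  exact Register.t.prob_get_uniform (fun _ => rfl) j

lemma prob_regE_stateAfter {i : Fin n} (hi : 0 < x i ∧ x i < 2 ^ m) {s : ℕ} (his : i.val < s)
    (Y : Fin (2 ^ m)) :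
    prob (stateAfter (u := u) x s) (fun w => regE w i = Y) = residueFreq u (x i) Y := by
  rw [stateAfter_eq, prob_uniform fun _ _ h => congrArg regH h, residueFreq_eq_sum]
  simp only [memory_apply_eq_iff his hi]

lemma prob_regT_uncomputed (x : Fin n → ℕ) :
    prob (uncomputed (m := m) (u := u) x) (fun w => regT w = zeroBits u) = 1 := by
  rw [uncomputed_eq]
  exact prob_uniform_of_forall (fun _ _ h => congrArg regH h) fun _ => rfl

lemma prob_regH_uncomputed (x : Fin n → ℕ) (j : Fin (2 ^ u)) :
    prob (uncomputed (m := m) x) (fun w => regH w = j) = 1 / 2 ^ u := by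
  rw [uncomputed_eq]
  exact Register.h.prob_get_uniform (fun _ => rfl) j

lemma prob_regE_uncomputed {i : Fin n} (hi : 0 < x i ∧ x i < 2 ^ m) (Y : Fin (2 ^ m)) :
    prob (uncomputed (u := u) x) (fun w => regE w i = Y) = residueFreq u (x i) Y := by
  rw [uncomputed_eq, prob_uniform fun _ _ h => congrArg regH h, residueFreq_eq_sum]
  simp only [memory_apply_eq_iff i.isLt hi]

lemma prob_regH_onH_qftInv_stateAfter (x : Fin n → ℕ) (s : ℕ) (k : Fin (2 ^ u)) :
    prob (onH (qftInv u) (stateAfter (m := m) x s)) (fun w => regH w = k) = 1 / 2 ^ u := by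
  rw [stateAfter_eq]
  exact Register.h.prob_get_qftInv (g := fun y => (y, y, zeroBits u, memory m x s y))
    (fun _ _ h => Prod.ext (congrArg regH h) (congrArg regT h)) (fun _ => rfl) k

lemma prob_regT_onT_qftInv_stateAfter (x : Fin n → ℕ) (s : ℕ) (k : Fin (2 ^ u)) :
    prob (onT (qftInv u) (stateAfter (m := m) x s)) (fun w => regT w = k) = 1 / 2 ^ u := by
  rw [stateAfter_eq]
  exact Register.t.prob_get_qftInv (g := fun y => (y, y, zeroBits u, memory m x s y))
    (fun _ _ h => Prod.ext (congrArg regT h) (congrArg regH h)) (fun _ => rfl) k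

lemma prob_regT_uncomputedCopy (x : Fin n → ℕ) {s : ℕ} (hs : s ≤ n) :
    prob (uncomputedCopy (m := m) (u := u) x s) (fun w => regT w = zeroBits u) = 1 := by
  rw [uncomputedCopy_eq x hs]
  exact prob_uniform_of_forall (fun _ _ h => congrArg regH h) fun _ => rfl

lemma prob_regH_final (hx : ∀ k, 0 < x k ∧ x k < 2 ^ m) (hT : T = Finset.univ.lcm x)
    (k : Fin (2 ^ u)) :
    prob (final (m := m) x) (fun w => regH w = k) =
      ∑ Z ∈ Finset.range T, classWeight u T Z k.val := by
  rw [final_eq hx hT, prob_superpose (injective_final_label hx hT), Fintype.sum_prod_type_right,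
    ← Fin.sum_univ_eq_sum_range fun Z => classWeight u T Z k.val]
  simp [norm_classAmplitude_sq, classWeight_neg]

lemma prob_regH_regE_final (hx : ∀ k, 0 < x k ∧ x k < 2 ^ m) (hT : T = Finset.univ.lcm x)
    (i : Fin n) (k : Fin (2 ^ u)) (Y : Fin (2 ^ m)) :
    prob (final x) (fun w => regH w = k ∧ regE w i = Y) =
      ∑ Z ∈ Finset.range T with Z % x i = Y.val, classWeight u T Z k.val := by
  rw [final_eq hx hT, prob_superpose (injective_final_label hx hT), Fintype.sum_prod_type_right,
    Finset.sum_filter,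
    ← Fin.sum_univ_eq_sum_range fun Z => if Z % x i = Y.val then classWeight u T Z k.val else 0]
  simp [norm_classAmplitude_sq, classWeight_neg, memory_apply_eq_iff i.isLt (hx i), ite_and]

lemma prob_regE_final (hx : ∀ k, 0 < x k ∧ x k < 2 ^ m) (i : Fin n) (Y : Fin (2 ^ m)) :
    prob (final (u := u) x) (fun w => regE w i = Y) = residueFreq u (x i) Y := by
  have hsum : ∀ Z, ∑ k : Fin (2 ^ u), classWeight u (Finset.univ.lcm x) Z k.val =
      residueFreq u (Finset.univ.lcm x) Z := fun Z => by
    simpa only [sub_zero] using sum_classWeight_sub u (Finset.univ.lcm x) Z 0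
  rw [prob_eq_sum_prob_and regH]
  simp only [prob_regH_regE_final hx rfl]
  rw [Finset.sum_comm]
  simp only [hsum]
  exact sum_residueFreq (lcm_pos fun k => (hx k).1) (Finset.dvd_lcm (Finset.mem_univ i)) u Y

lemma prob_regH_final_of_dvd (hx : ∀ k, 0 < x k ∧ x k < 2 ^ m) (hT : T = Finset.univ.lcm x)
    (hdvd : T ∣ 2 ^ u) (k : Fin (2 ^ u)) :
    prob (final (m := m) x) (fun w => regH w = k) =
      if 2 ^ u / T ∣ k.val then 1 / (T : ℝ) else 0 := by
  rw [prob_regH_final hx hT,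
    sum_classWeight_range_of_dvd (hT ▸ lcm_pos fun k => (hx k).1) hdvd]
  simp only [Int.natCast_dvd_natCast]

lemma prob_regE_afterPeriodFinding_of_dvd (hx : ∀ k, 0 < x k ∧ x k < 2 ^ m)
    (hT : T = Finset.univ.lcm x) (hdvd : T ∣ 2 ^ u) {k : Fin (2 ^ u)} (hk : 2 ^ u / T ∣ k.val)
    {i : Fin n} {Y : Fin (2 ^ m)} (hY : Y.val < x i) :
    prob (afterPeriodFinding x k) (fun w => regE w i = Y) = 1 / x i := by
  have hTpos : 0 < T := hT ▸ lcm_pos fun k => (hx k).1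
  have hTne : (T : ℝ) ≠ 0 := by exact_mod_cast hTpos.ne'
  have hi : x i ∣ T := hT ▸ Finset.dvd_lcm (Finset.mem_univ i)
  rw [afterPeriodFinding, prob_collapse, prob_regH_regE_final hx hT, prob_regH_final_of_dvd hx hT
    hdvd, sum_classWeight_filter_of_dvd hTpos hi hY hdvd, if_pos hk,
    if_pos (Int.natCast_dvd_natCast.2 hk), mul_div_cancel_left₀ _ (one_div_ne_zero hTne)]

lemma prob_regC_attackedCopy (hx : ∀ k, 0 < x k ∧ x k < 2 ^ m) (hT : T = Finset.univ.lcm x)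
    {s : ℕ} (hs : s ≤ n) (k l : Fin (2 ^ u)) :
    prob (attackedCopy (m := m) x s k) (fun w => regC w = l) =
      ∑ Z ∈ Finset.range T, classWeight u T Z ((l.val : ℤ) - k.val) := by
  rw [attackedCopy_eq hx hT hs, prob_superpose (injective_attackedCopy_label hx hT k),
    Fintype.sum_prod_type_right,
    ← Fin.sum_univ_eq_sum_range fun Z => classWeight u T Z ((l.val : ℤ) - k.val)]
  simp [norm_classAmplitude_sq]

lemma prob_regC_attackedCopy_of_dvd (hx : ∀ k, 0 < x k ∧ x k < 2 ^ m)
    (hT : T = Finset.univ.lcm x) (hdvd : T ∣ 2 ^ u) {s : ℕ} (hs : s ≤ n) (k l : Fin (2 ^ u))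
    [Decidable (∃ r < T, l.val = (k.val + r * (2 ^ u / T)) % 2 ^ u)] :
    prob (attackedCopy (m := m) x s k) (fun w => regC w = l) =
      if ∃ r < T, l.val = (k.val + r * (2 ^ u / T)) % 2 ^ u then 1 / (T : ℝ) else 0 := by
  have hcong := exists_lt_eq_add_mul_mod_iff (T := T) (M := 2 ^ u / T) (k := k.val) (l := l.val)
  rw [Nat.mul_div_cancel' hdvd] at hcong
  rw [prob_regC_attackedCopy hx hT hs,
    sum_classWeight_range_of_dvd (hT ▸ lcm_pos fun k => (hx k).1) hdvd]
  exact if_congr (hcong l.isLt).symm rfl rfl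

lemma sum_prob_regH_finalCopy_mul_prob_regC_attackedCopy (hx : ∀ k, 0 < x k ∧ x k < 2 ^ m)
    {s : ℕ} (hs : s ≤ n) (l : Fin (2 ^ u)) :
    ∑ k : Fin (2 ^ u), prob (finalCopy (m := m) x s) (fun w => regH w = k) *
      prob (attackedCopy (m := m) x s k) (fun w => regC w = l) = 1 / 2 ^ u := by
  have hneg : ∀ (Z : ℕ) (k : Fin (2 ^ u)),
      classWeight u (Finset.univ.lcm x) Z ((l.val : ℤ) - k.val) =
        classWeight u (Finset.univ.lcm x) Z (k.val - l.val) := fun Z k => by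
    rw [← classWeight_neg, neg_sub]
  simp only [prob_regH_finalCopy x hs, prob_regC_attackedCopy hx rfl hs, hneg]
  rw [← Finset.mul_sum, Finset.sum_comm]
  simp only [sum_classWeight_sub]
  rw [sum_residueFreq_range (lcm_pos fun k => (hx k).1), mul_one]

end Distributions

section Views

variable {x x' : Fin n → ℕ} {i : Fin n} {T : ℕ}

lemma view_stateAfter_congr (hi : x' i = x i) (s : ℕ) :
    view i (stateAfter (m := m) (u := u) x' s) = view i (stateAfter x s) := by
  rw [stateAfter_eq, stateAfter_eq]
  exact view_superpose_congr (fun _ _ h => congrArg regH h) (fun _ _ h => congrArg regH h)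
    (fun y => by simp only [regE, memory_apply_congr hi]) _

lemma view_uncomputed_congr (hi : x' i = x i) :
    view i (uncomputed (m := m) (u := u) x') = view i (uncomputed x) := by
  rw [uncomputed_eq, uncomputed_eq]
  exact view_superpose_congr (fun _ _ h => congrArg regH h) (fun _ _ h => congrArg regH h)
    (fun y => by simp only [regE, memory_apply_congr hi]) _

lemma view_onH_qftInv_stateAfter_congr (hi : x' i = x i) (s : ℕ) :
    view i (onH (qftInv u) (stateAfter (m := m) x' s)) =
      view i (onH (qftInv u) (stateAfter x s)) := by
  rw [onH_qftInv_stateAfter_eq, onH_qftInv_stateAfter_eq]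
  refine view_superpose_congr ?_ ?_ (fun p => by simp only [regE, memory_apply_congr hi]) _ <;>
    exact fun _ _ h => Prod.ext (congrArg regH h) (congrArg regT h)

lemma view_onT_qftInv_stateAfter_congr (hi : x' i = x i) (s : ℕ) :
    view i (onT (qftInv u) (stateAfter (m := m) x' s)) =
      view i (onT (qftInv u) (stateAfter x s)) := by
  rw [onT_qftInv_stateAfter_eq, onT_qftInv_stateAfter_eq]
  exact view_superpose_congr (fun _ _ h => Prod.ext (congrArg regT h) (congrArg regH h))
    (fun _ _ h => Prod.ext (congrArg regT h) (congrArg regH h))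
    (fun p => by simp only [regE, memory_apply_congr hi]) _

variable (hx : ∀ k, 0 < x k ∧ x k < 2 ^ m) (hx' : ∀ k, 0 < x' k ∧ x' k < 2 ^ m)
  (hT : T = Finset.univ.lcm x) (hT' : T = Finset.univ.lcm x') (hi : x' i = x i)
include hx hx' hT hT' hi

lemma view_final_congr : view i (final (m := m) (u := u) x') = view i (final x) := by
  rw [final_eq hx hT, final_eq hx' hT']
  exact view_superpose_congr (injective_final_label hx' hT') (injective_final_label hx hT)
    (fun p => by simp only [regE, memory_apply_congr hi]) _

lemma view_afterPeriodFinding_congr (k : Fin (2 ^ u)) :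
    view i (afterPeriodFinding (m := m) x' k) = view i (afterPeriodFinding x k) := by
  have hk := prob_regH_final hx hT k
  have hk' := prob_regH_final hx' hT' k
  rw [afterPeriodFinding, afterPeriodFinding, final_eq hx hT, final_eq hx' hT'] at *
  rw [collapse_superpose_prod fun _ => Iff.rfl, collapse_superpose_prod fun _ => Iff.rfl, hk, hk']
  exact view_superpose_congr (fun _ _ h => memory_injective hx' hT' (congrArg regE h))
    (fun _ _ h => memory_injective hx hT (congrArg regE h))
    (fun Z => by simp only [regE, memory_apply_congr hi]) _

lemma view_attackedCopy_congr {s : ℕ} (hs : s ≤ n) (k : Fin (2 ^ u)) :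
    view i (attackedCopy (m := m) x' s k) = view i (attackedCopy x s k) := by
  rw [attackedCopy_eq hx hT hs, attackedCopy_eq hx' hT' hs]
  exact view_superpose_congr (injective_attackedCopy_label hx' hT' k)
    (injective_attackedCopy_label hx hT k) (fun p => by simp only [regE, memory_apply_congr hi]) _

end Views

end QLCM

open QLCM in
theorem theorem3 (n m u : ℕ) (x : Fin n → ℕ) (hx : ∀ k, 0 < x k ∧ x k < 2 ^ m)
    (T : ℕ) (hT : T = Finset.univ.lcm x) (i : Fin n) :
    -- Direct measurement while the oracles are being applied (`s` parties have finished).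
    (∀ s ≤ n,
      (∀ j : Fin (2 ^ u), prob (stateAfter (m := m) x s) (fun w => regH w = j) = 1 / 2 ^ u) ∧
      (∀ j : Fin (2 ^ u), prob (stateAfter (m := m) x s) (fun w => regT w = j) = 1 / 2 ^ u) ∧
      (i.val < s → ∀ Y : Fin (2 ^ m),
        prob (stateAfter (u := u) x s) (fun w => regE w i = Y) = residueFreq u (x i) Y)) ∧
    -- Direct measurement after the second CNOT, which leaves `t` in state zero.
    (prob (uncomputed (m := m) (u := u) x) (fun w => regT w = zeroBits u) = 1 ∧
      (∀ j : Fin (2 ^ u), prob (uncomputed (m := m) x) (fun w => regH w = j) = 1 / 2 ^ u) ∧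
      (∀ Y : Fin (2 ^ m),
        prob (uncomputed (u := u) x) (fun w => regE w i = Y) = residueFreq u (x i) Y)) ∧
    -- Direct measurement of `e i` and of `h` at the end of period finding.
    ((∀ Y : Fin (2 ^ m),
        prob (final (u := u) x) (fun w => regE w i = Y) = residueFreq u (x i) Y) ∧
      (∀ (k : Fin (2 ^ u)) (Y : Fin (2 ^ m)),
        prob (final x) (fun w => regH w = k ∧ regE w i = Y)
          = ∑ Z ∈ (Finset.range T).filter (fun Z => Z % x i = Y.val),
              classWeight u T Z k.val) ∧
      (T ∣ 2 ^ u → ∀ k : Fin (2 ^ u),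
        ((2 ^ u / T) ∣ k.val →
          prob (final (m := m) x) (fun w => regH w = k) = 1 / T ∧
          ∀ Y : Fin (2 ^ m), Y.val < x i →
            prob (afterPeriodFinding x k) (fun w => regE w i = Y) = 1 / x i) ∧
        (¬ (2 ^ u / T) ∣ k.val →
          prob (final (m := m) x) (fun w => regH w = k) = 0))) ∧
    -- The frequencies above are close to the uniform distribution on the residues modulo `x i`.
    (∀ Y < x i, |residueFreq u (x i) Y - 1 / x i| < 1 / 2 ^ u ∧
      (x i ∣ 2 ^ u → residueFreq u (x i) Y = 1 / x i)) ∧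
    -- Inverse Fourier transform on `h` or on `t` before period finding.
    (∀ s ≤ n,
      (∀ k : Fin (2 ^ u),
        prob (onH (qftInv u) (stateAfter (m := m) x s)) (fun w => regH w = k) = 1 / 2 ^ u) ∧
      (∀ k : Fin (2 ^ u),
        prob (onT (qftInv u) (stateAfter (m := m) x s)) (fun w => regT w = k) = 1 / 2 ^ u)) ∧
    -- Copying `t` at time `s`, and a Fourier transform on the copy after period finding.
    (∀ s ≤ n,
      prob (uncomputedCopy (m := m) (u := u) x s) (fun w => regT w = zeroBits u) = 1 ∧
      (∀ k : Fin (2 ^ u),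
        prob (finalCopy (m := m) x s) (fun w => regH w = k) = 1 / 2 ^ u) ∧
      (∀ k l : Fin (2 ^ u),
        prob (attackedCopy (m := m) x s k) (fun w => regC w = l)
          = ∑ Z ∈ Finset.range T, classWeight u T Z ((l.val : ℤ) - k.val)) ∧
      (T ∣ 2 ^ u → ∀ k l : Fin (2 ^ u),
        ((∃ r < T, l.val = (k.val + r * (2 ^ u / T)) % 2 ^ u) →
          prob (attackedCopy (m := m) x s k) (fun w => regC w = l) = 1 / T) ∧
        ((¬ ∃ r < T, l.val = (k.val + r * (2 ^ u / T)) % 2 ^ u) →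
          prob (attackedCopy (m := m) x s k) (fun w => regC w = l) = 0)) ∧
      (∀ l : Fin (2 ^ u),
        ∑ k : Fin (2 ^ u), prob (finalCopy (m := m) x s) (fun w => regH w = k)
          * prob (attackedCopy (m := m) x s k) (fun w => regC w = l) = 1 / 2 ^ u)) ∧
    -- Nothing beyond the attacker's own input is revealed before period finding is completed,
    -- and nothing beyond that input and `T` afterwards, even by joint measurements.
    (∀ x' : Fin n → ℕ, (∀ k, 0 < x' k ∧ x' k < 2 ^ m) → x' i = x i →
      (∀ s ≤ n, ∀ (a b c : Fin (2 ^ u)) (Y : Fin (2 ^ m)),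
        view i (stateAfter x' s) a b c Y = view i (stateAfter x s) a b c Y ∧
        view i (onH (qftInv u) (stateAfter x' s)) a b c Y
          = view i (onH (qftInv u) (stateAfter x s)) a b c Y ∧
        view i (onT (qftInv u) (stateAfter x' s)) a b c Y
          = view i (onT (qftInv u) (stateAfter x s)) a b c Y) ∧
      (∀ (a b c : Fin (2 ^ u)) (Y : Fin (2 ^ m)),
        view i (uncomputed x') a b c Y = view i (uncomputed x) a b c Y) ∧
      (Finset.univ.lcm x' = T →
        (∀ (a b c : Fin (2 ^ u)) (Y : Fin (2 ^ m)),
          view i (final x') a b c Y = view i (final x) a b c Y) ∧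
        (∀ (k a b c : Fin (2 ^ u)) (Y : Fin (2 ^ m)),
          view i (afterPeriodFinding x' k) a b c Y = view i (afterPeriodFinding x k) a b c Y) ∧
        (∀ s ≤ n, ∀ (k a b c : Fin (2 ^ u)) (Y : Fin (2 ^ m)),
          prob (finalCopy (m := m) x' s) (fun w => regH w = k)
            = prob (finalCopy (m := m) x s) (fun w => regH w = k) ∧
          view i (attackedCopy x' s k) a b c Y = view i (attackedCopy x s k) a b c Y))) := by
  classical
  refine ⟨fun s _ => ⟨prob_regH_stateAfter x s, prob_regT_stateAfter x s,
      prob_regE_stateAfter (hx i)⟩,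
    ⟨prob_regT_uncomputed x, prob_regH_uncomputed x, prob_regE_uncomputed (hx i)⟩,
    ⟨prob_regE_final hx i, prob_regH_regE_final hx hT i, fun hdvd k =>
      ⟨fun hk => ⟨(prob_regH_final_of_dvd hx hT hdvd k).trans (if_pos hk),
        fun _ => prob_regE_afterPeriodFinding_of_dvd hx hT hdvd hk⟩,
      fun hk => (prob_regH_final_of_dvd hx hT hdvd k).trans (if_neg hk)⟩⟩,
    fun Y hY => ⟨abs_residueFreq_sub_lt hY u, residueFreq_of_dvd hY⟩,
    fun s _ => ⟨prob_regH_onH_qftInv_stateAfter x s, prob_regT_onT_qftInv_stateAfter x s⟩,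
    fun s hs => ⟨prob_regT_uncomputedCopy x hs, prob_regH_finalCopy x hs,
      prob_regC_attackedCopy hx hT hs, fun hdvd k l =>
        ⟨fun h => (prob_regC_attackedCopy_of_dvd hx hT hdvd hs k l).trans (if_pos h),
        fun h => (prob_regC_attackedCopy_of_dvd hx hT hdvd hs k l).trans (if_neg h)⟩,
      sum_prob_regH_finalCopy_mul_prob_regC_attackedCopy hx hs⟩,
    fun x' hx' hi => ⟨fun s _ a b c Y => ?_, fun a b c Y => ?_, fun hT' => ?_⟩⟩
  · simp only [view_stateAfter_congr hi, view_onH_qftInv_stateAfter_congr hi,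
      view_onT_qftInv_stateAfter_congr hi, and_self]
  · rw [view_uncomputed_congr hi]
  · refine ⟨fun a b c Y => ?_, fun k a b c Y => ?_, fun s hs k a b c Y => ⟨?_, ?_⟩⟩
    · rw [view_final_congr hx hx' hT hT'.symm hi]
    · rw [view_afterPeriodFinding_congr hx hx' hT hT'.symm hi]
    · rw [prob_regH_finalCopy x' hs, prob_regH_finalCopy x hs]
    · rw [view_attackedCopy_congr hx hx' hT hT'.symm hi hs]
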